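/- Let $n\ge 1$. For $s\in\mathbb R$ and $0<q,r\le\infty$, the homogeneous Herz space $\dot K^{s}_{q,r}(\mathbb R^n)$ is the space of all (real- or complex-valued) measurable functions $f$ on $\mathbb R^n$, modulo equality almost everywhere, for which the quasi-norm $$\|f\|_{\dot K^s_{q,r}}=\Big(\sum_{j\in\mathbb Z}\big[2^{js}\|f\chi_{A_j}\|_{L^q}\big]^r\Big)^{1/r}\ (r<\infty),\qquad \|f\|_{\dot K^s_{q,\infty}}=\sup_{j\in\mathbb Z}2^{js}\|f\chi_{A_j}\|_{L^q},$$ is finite, where $A_j=\{x\in\mathbb R^n: 2^{j-1}\le|x|<2^j\}$. For two quasi-normed spaces $X_0,X_1$ of measurable functions, $0<\theta<1$ and $0<r\le\infty$, put $$K(t,f)=\inf\{\|f_0\|_{X_0}+t\|f_1\|_{X_1}: f=f_0+f_1,\ f_0\in X_0,\ f_1\in X_1\}\quad(t>0),$$ with $K(t,f)=\infty$ if $f\notin X_0+X_1$, and let $(X_0,X_1)_{\theta,r}$ be the space of all measurable $f$ with $$\|f\|_{(X_0,X_1)_{\theta,r}}=\Big(\int_0^\infty[t^{-\theta}K(t,f)]^r\,\frac{dt}{t}\Big)^{1/r}<\infty\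 (r<\infty),\qquad \|f\|_{(X_0,X_1)_{\theta,\infty}}=\sup_{t>0}t^{-\theta}K(t,f)<\infty .$$ **Theorem.** Let $0<\theta<1$, $s,s_0,s_1\in\mathbb R$ and $0<q,r,r_0,r_1\le\infty$. If $s_0\ne s_1$ and $s=(1-\theta)s_0+\theta s_1$, then $$\big(\dot K^{s_0}_{q,r_0}(\mathbb R^n),\dot K^{s_1}_{q,r_1}(\mathbb R^n)\big)_{\theta,r}=\dot K^{s}_{q,r}(\mathbb R^n)$$ as sets, with equivalent quasi-norms: there are constants $c,C\in(0,\infty)$ such that for every $f\in\dot K^{s}_{q,r}(\mathbb R^n)$, $$c\,\|f\|_{\dot K^{s}_{q,r}}\le\|f\|_{(\dot K^{s_0}_{q,r_0},\dot K^{s_1}_{q,r_1})_{\theta,r}}\le C\,\|f\|_{\dot K^{s}_{q,r}}.$$ -/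

import Mathlib

open scoped ENNReal NNReal
open MeasureTheory

noncomputable section

/-- The dyadic annulus `A_j = {x ∈ ℝⁿ : 2^(j-1) ≤ |x| < 2^j}`, `j ∈ ℤ`, for the Euclidean norm. -/
def dyadicAnnulus (n : ℕ) (j : ℤ) : Set (EuclideanSpace ℝ (Fin n)) :=
  {x | (2 : ℝ) ^ (j - 1) ≤ ‖x‖ ∧ ‖x‖ < (2 : ℝ) ^ j}

/-- Measurable `𝕜`-valued functions on `ℝⁿ`, identified when they agree Lebesgue-almost everywhere. -/
abbrev MeasFun (n : ℕ) (𝕜 : Type*) [RCLike 𝕜] : Type _ :=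
  EuclideanSpace ℝ (Fin n) →ₘ[volume] 𝕜

/-- The homogeneous Herz quasi-norm `‖f‖` of `K̇^s_{q,r}(ℝⁿ)`, with the value `∞` when `f` does not
belong to the space. -/
def herzNorm {n : ℕ} {𝕜 : Type*} [RCLike 𝕜] (s : ℝ) (q r : ℝ≥0∞) (f : MeasFun n 𝕜) : ℝ≥0∞ :=
  if r = ∞ then
    ⨆ j : ℤ, (2 : ℝ≥0∞) ^ ((j : ℝ) * s) * eLpNorm ((dyadicAnnulus n j).indicator f) q volume
  else
    (∑' j : ℤ, ((2 : ℝ≥0∞) ^ ((j : ℝ) * s) *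
      eLpNorm ((dyadicAnnulus n j).indicator f) q volume) ^ r.toReal) ^ (1 / r.toReal)

/-- The homogeneous Herz space `K̇^s_{q,r}(ℝⁿ)`. -/
def herzSpace (n : ℕ) (𝕜 : Type*) [RCLike 𝕜] (s : ℝ) (q r : ℝ≥0∞) : Set (MeasFun n 𝕜) :=
  {f | herzNorm s q r f < ∞}

/-- The `K`-functional of the couple `(X₀, X₁)` where `X_i = {f : N_i f < ∞}`:
the infimum of `N₀ f₀ + t N₁ f₁` over `f = f₀ + f₁` with `f₀ ∈ X₀`, `f₁ ∈ X₁`.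
It is `∞` (an empty infimum) exactly when `f ∉ X₀ + X₁`. -/
def kFunctional {G : Type*} [AddCommGroup G] (N₀ N₁ : G → ℝ≥0∞) (t : ℝ) (f : G) : ℝ≥0∞ :=
  ⨅ (f₀ : G) (f₁ : G) (_ : f = f₀ + f₁) (_ : N₀ f₀ < ∞) (_ : N₁ f₁ < ∞),
    (N₀ f₀ + ENNReal.ofReal t * N₁ f₁)

/-- The quasi-norm of the real interpolation space `(X₀, X₁)_{θ,r}`, `X_i = {f : N_i f < ∞}`,
with the value `∞` when `f` does not belong to the space. -/
def realInterpNorm {G : Type*} [AddCommGroup G] (N₀ N₁ : G → ℝ≥0∞) (θ : ℝ) (r : ℝ≥0∞)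
    (f : G) : ℝ≥0∞ :=
  if r = ∞ then
    ⨆ (t : ℝ) (_ : 0 < t), ENNReal.ofReal t ^ (-θ) * kFunctional N₀ N₁ t f
  else
    (∫⁻ t in Set.Ioi (0 : ℝ),
      (ENNReal.ofReal t ^ (-θ) * kFunctional N₀ N₁ t f) ^ r.toReal / ENNReal.ofReal t)
        ^ (1 / r.toReal)

/-- The real interpolation space `(X₀, X₁)_{θ,r}`, `X_i = {f : N_i f < ∞}`. -/
def realInterpSpace {G : Type*} [AddCommGroup G] (N₀ N₁ : G → ℝ≥0∞) (θ : ℝ) (r : ℝ≥0∞) : Set G :=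
  {f | realInterpNorm N₀ N₁ θ r f < ∞}

end

/-! Put d = s₀ - s₁ and b_j = 2^(js) ‖f χ_{A_j}‖_q, so that the target quasi-norm is the ℓ^r
quasi-norm of b. The interpolation quasi-norm is equivalent to the ℓ^r quasi-norm of the samples
2^(-kdθ) K(2^(kd), f), because K is monotone in t. So it suffices to compare these samples with b.

Lower bound (`annulusNorm_le_scaleSample`): for any f = f₀ + f₁, the k-th annulus alone bounds b_k
by a constant times the k-th sample, since s = s₀ - θd.

Upper bound (`exists_scaleSample_le_iSup`): cut f at the k-th annulus, sending the annuli with jd ≤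
kd to X₀ and the others to X₁. Both pieces decay geometrically in |k - j|, so the sample is at most
a constant times sup_j 2^(-ε|k-j|) b_j, whatever r₀ and r₁ are. `lrNorm_iSup_expWeight_mul_le`
bounds the ℓ^r quasi-norm of this supremum by that of b. -/

noncomputable section

/-! ### Sequence quasi-norms. -/

/-- The `ℓ^r` quasi-norm of a two-sided sequence of extended nonnegative numbers. -/
def lrNorm (r : ℝ≥0∞) (x : ℤ → ℝ≥0∞) : ℝ≥0∞ :=
  if r = ∞ then ⨆ j, x j else (∑' j, x j ^ r.toReal) ^ (1 / r.toReal)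

lemma lrNorm_top (x : ℤ → ℝ≥0∞) : lrNorm ∞ x = ⨆ j, x j := by simp [lrNorm]

lemma lrNorm_of_ne_top {r : ℝ≥0∞} (h : r ≠ ∞) (x : ℤ → ℝ≥0∞) :
    lrNorm r x = (∑' j, x j ^ r.toReal) ^ (1 / r.toReal) := by simp [lrNorm, h]

lemma lrNorm_mono (r : ℝ≥0∞) {x y : ℤ → ℝ≥0∞} (h : ∀ j, x j ≤ y j) :
    lrNorm r x ≤ lrNorm r y := by
  unfold lrNorm
  split_ifs
  · exact iSup_mono h
  · gcongr with j
    exact h j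

lemma lrNorm_comp_equiv (r : ℝ≥0∞) (x : ℤ → ℝ≥0∞) (e : ℤ ≃ ℤ) :
    lrNorm r (fun j => x (e j)) = lrNorm r x := by
  unfold lrNorm
  split_ifs
  · exact e.iSup_comp
  · rw [e.tsum_eq (fun j => x j ^ r.toReal)]

lemma lrNorm_const_mul {r : ℝ≥0∞} (hr : 0 < r) (c : ℝ≥0∞) (x : ℤ → ℝ≥0∞) :
    lrNorm r (fun j => c * x j) = c * lrNorm r x := by
  unfold lrNorm
  split_ifs with h
  · exact (ENNReal.mul_iSup ..).symm
  · have hp : 0 < r.toReal := ENNReal.toReal_pos hr.ne' h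
    simp_rw [ENNReal.mul_rpow_of_nonneg _ _ hp.le]
    rw [ENNReal.tsum_mul_left, ENNReal.mul_rpow_of_nonneg _ _ (by positivity), ← ENNReal.rpow_mul,
      mul_one_div_cancel hp.ne', ENNReal.rpow_one]

lemma le_lrNorm {r : ℝ≥0∞} (hr : 0 < r) (x : ℤ → ℝ≥0∞) (j : ℤ) : x j ≤ lrNorm r x := by
  unfold lrNorm
  split_ifs with h
  · exact le_iSup x j
  · have hp : 0 < r.toReal := ENNReal.toReal_pos hr.ne' h
    rw [one_div, ENNReal.le_rpow_inv_iff hp]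
    exact ENNReal.le_tsum (f := fun j => x j ^ r.toReal) j

/-! ### Geometric weights and discrete convolution bounds. -/

/-- The weight `2^(-ε|j|)`. -/
def expWeight (ε : ℝ) (j : ℤ) : ℝ≥0∞ := 2 ^ (-(ε * |(j : ℝ)|))

lemma two_rpow_add (x y : ℝ) : (2 : ℝ≥0∞) ^ (x + y) = 2 ^ x * 2 ^ y :=
  ENNReal.rpow_add _ _ (by norm_num) (by norm_num)

lemma two_rpow_ne_top (x : ℝ) : (2 : ℝ≥0∞) ^ x ≠ ∞ := by
  simp [ENNReal.rpow_eq_top_iff]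

lemma two_rpow_mono {x y : ℝ} (h : x ≤ y) : (2 : ℝ≥0∞) ^ x ≤ 2 ^ y :=
  ENNReal.rpow_le_rpow_of_exponent_le (by norm_num) h

lemma ofReal_two_rpow (x : ℝ) : ENNReal.ofReal ((2 : ℝ) ^ x) = 2 ^ x := by
  rw [← ENNReal.ofReal_rpow_of_pos (by norm_num)]
  simp

lemma expWeight_rpow (ε p : ℝ) (j : ℤ) : expWeight ε j ^ p = expWeight (ε * p) j := by
  unfold expWeight
  rw [← ENNReal.rpow_mul]
  congr 1
  ring

lemma expWeight_le_one {ε : ℝ} (hε : 0 ≤ ε) (j : ℤ) : expWeight ε j ≤ 1 := by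
  have := two_rpow_mono (x := -(ε * |(j : ℝ)|)) (y := 0) (by simp; positivity)
  simpa [expWeight] using this

lemma expWeight_add (ε δ : ℝ) (j : ℤ) :
    expWeight (ε + δ) j = expWeight ε j * expWeight δ j := by
  unfold expWeight
  rw [← two_rpow_add]
  congr 1
  ring

lemma tsum_expWeight_ne_top {ε : ℝ} (hε : 0 < ε) : ∑' j, expWeight ε j ≠ ∞ := by
  have h1 : ∀ j, expWeight ε j = ENNReal.ofReal ((2 : ℝ) ^ (-(ε * |(j : ℝ)|))) := fun j => by
    rw [ofReal_two_rpow]; rfl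
  simp_rw [h1]
  apply Summable.tsum_ofReal_ne_top
  have h2 : Summable fun n : ℕ => ((2 : ℝ) ^ (-ε)) ^ n :=
    summable_geometric_of_lt_one (by positivity)
      (Real.rpow_lt_one_of_one_lt_of_neg (by norm_num) (by linarith))
  have h3 : ∀ n : ℕ, (2 : ℝ) ^ (-(ε * (n : ℝ))) = ((2 : ℝ) ^ (-ε)) ^ n := fun n => by
    rw [← Real.rpow_mul_natCast (by norm_num)]
    congr 1
    ring
  apply Summable.of_nat_of_neg
  · simpa [h3] using h2
  · simpa [h3] using h2

lemma lrNorm_expWeight_ne_top {ε : ℝ} (hε : 0 < ε) {r : ℝ≥0∞} (hr : 0 < r) :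
    lrNorm r (expWeight ε) ≠ ∞ := by
  unfold lrNorm
  split_ifs with h
  · exact ne_top_of_le_ne_top ENNReal.one_ne_top (iSup_le fun j => expWeight_le_one hε.le j)
  · have hp : 0 < r.toReal := ENNReal.toReal_pos hr.ne' h
    simp_rw [expWeight_rpow]
    exact ENNReal.rpow_ne_top_of_nonneg (by positivity) (tsum_expWeight_ne_top (by positivity))

/-- Half of the decay pays for summability and the other half stays in the supremum. This is what
makes the exponents r₀, r₁ irrelevant. -/
lemma lrNorm_expWeight_mul_le {r : ℝ≥0∞} (hr : 0 < r) (ε : ℝ) (b : ℤ → ℝ≥0∞) (k : ℤ) :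
    lrNorm r (fun j => expWeight (ε + ε) (k - j) * b j) ≤
      lrNorm r (expWeight ε) * ⨆ j, expWeight ε (k - j) * b j := by
  have h := lrNorm_comp_equiv r (expWeight ε) (Equiv.subLeft k)
  rw [← h, mul_comm, ← lrNorm_const_mul hr]
  refine lrNorm_mono r fun j => ?_
  rw [expWeight_add, mul_comm (⨆ j, _), mul_assoc]
  gcongr
  · rfl
  · exact le_iSup (fun j => expWeight ε (k - j) * b j) j

/-- A substitute for Young's inequality that also covers r < 1: the r-th power of a supremum is at
most the sum of the r-th powers, after which the sums are exchanged. -/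
lemma lrNorm_iSup_expWeight_mul_le {r : ℝ≥0∞} (hr : 0 < r) (ε : ℝ)
    (b : ℤ → ℝ≥0∞) :
    lrNorm r (fun k => ⨆ j, expWeight ε (k - j) * b j) ≤
      lrNorm r (expWeight ε) * lrNorm r b := by
  rcases eq_or_ne r ∞ with rfl | h
  · simp only [lrNorm_top]
    refine iSup_le fun k => iSup_le fun j => mul_le_mul' ?_ (le_iSup b j)
    exact le_iSup (expWeight ε) (k - j)
  · have hp : 0 < r.toReal := ENNReal.toReal_pos hr.ne' h
    simp only [lrNorm_of_ne_top h]
    rw [← ENNReal.mul_rpow_of_nonneg _ _ (by positivity)]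
    gcongr
    calc ∑' k, (⨆ j, expWeight ε (k - j) * b j) ^ r.toReal
        ≤ ∑' k, ∑' j, (expWeight ε (k - j) * b j) ^ r.toReal := by
          gcongr with k
          rw [← ENNReal.le_rpow_inv_iff hp]
          refine iSup_le fun j => ?_
          rw [ENNReal.le_rpow_inv_iff hp]
          exact ENNReal.le_tsum (f := fun j => (expWeight ε (k - j) * b j) ^ r.toReal) j
      _ = ∑' j, (∑' k, expWeight ε (k - j) ^ r.toReal) * b j ^ r.toReal := by
          rw [ENNReal.tsum_comm]
          simp_rw [ENNReal.mul_rpow_of_nonneg _ _ hp.le, ENNReal.tsum_mul_right]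
      _ = (∑' k, expWeight ε k ^ r.toReal) * ∑' j, b j ^ r.toReal := by
          rw [← ENNReal.tsum_mul_left]
          congr! 3 with j
          exact (Equiv.subRight j).tsum_eq (fun k => expWeight ε k ^ r.toReal)

/-! ### Discretization of the integral in t. -/

/-- The dyadic block `[2^(kd), 2^((k+1)d))` of the half-line. -/
def scaleBlock (d : ℝ) (k : ℤ) : Set ℝ := Set.Ico ((2 : ℝ) ^ (k * d)) ((2 : ℝ) ^ ((k + 1) * d))

lemma measurableSet_scaleBlock (d : ℝ) (k : ℤ) : MeasurableSet (scaleBlock d k) :=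
  measurableSet_Ico

lemma pos_of_mem_scaleBlock {d : ℝ} {k : ℤ} {t : ℝ} (ht : t ∈ scaleBlock d k) : 0 < t :=
  lt_of_lt_of_le (by positivity) ht.1

lemma exists_mem_scaleBlock {d : ℝ} (hd : 0 < d) {t : ℝ} (ht : 0 < t) :
    ∃ k, t ∈ scaleBlock d k := by
  refine ⟨⌊Real.logb 2 t / d⌋, ?_, ?_⟩
  · rw [← Real.le_logb_iff_rpow_le (by norm_num) ht, ← le_div_iff₀ hd]
    exact Int.floor_le _
  · rw [← Real.logb_lt_iff_lt_rpow (by norm_num) ht, ← div_lt_iff₀ hd]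
    exact Int.lt_floor_add_one _

lemma iUnion_scaleBlock {d : ℝ} (hd : 0 < d) : ⋃ k, scaleBlock d k = Set.Ioi 0 := by
  ext t
  simp only [Set.mem_iUnion, Set.mem_Ioi]
  exact ⟨fun ⟨k, hk⟩ => pos_of_mem_scaleBlock hk, fun ht => exists_mem_scaleBlock hd ht⟩

lemma pairwise_disjoint_scaleBlock {d : ℝ} (hd : 0 < d) :
    Pairwise (Function.onFun Disjoint (scaleBlock d)) := by
  have hm : Monotone fun k : ℤ => (2 : ℝ) ^ ((k : ℝ) * d) := fun a b hab => by
    have : (a : ℝ) ≤ b := by exact_mod_cast hab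
    exact Real.rpow_le_rpow_of_exponent_le (by norm_num) (by gcongr)
  have := hm.pairwise_disjoint_on_Ico_succ
  intro a b hab
  simpa [scaleBlock, Function.onFun, Order.succ_eq_add_one] using this hab

lemma volume_scaleBlock (d : ℝ) (k : ℤ) :
    volume (scaleBlock d k) = 2 ^ ((k : ℝ) * d) * ENNReal.ofReal ((2 : ℝ) ^ d - 1) := by
  rw [scaleBlock, Real.volume_Ico, ← ofReal_two_rpow, ← ENNReal.ofReal_mul (by positivity)]
  congr 1
  rw [mul_sub, ← Real.rpow_add (by norm_num)]
  ring_nf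

lemma two_rpow_le_ofReal {d : ℝ} {k : ℤ} {t : ℝ} (ht : t ∈ scaleBlock d k) :
    (2 : ℝ≥0∞) ^ ((k : ℝ) * d) ≤ ENNReal.ofReal t := by
  rw [← ofReal_two_rpow]
  exact ENNReal.ofReal_le_ofReal ht.1

lemma ofReal_le_two_rpow {d : ℝ} {k : ℤ} {t : ℝ} (ht : t ∈ scaleBlock d k) :
    ENNReal.ofReal t ≤ (2 : ℝ≥0∞) ^ (((k : ℝ) + 1) * d) := by
  rw [← ofReal_two_rpow]
  exact ENNReal.ofReal_le_ofReal ht.2.le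

/-- For d > 0 all blocks have the same dt/t measure; bounding 1/t by its endpoint values is precise
enough here and in the reverse estimate. -/
lemma setLIntegral_inv_scaleBlock_le (d : ℝ) (k : ℤ) :
    ∫⁻ t in scaleBlock d k, (ENNReal.ofReal t)⁻¹ ≤ ENNReal.ofReal ((2 : ℝ) ^ d - 1) := by
  calc ∫⁻ t in scaleBlock d k, (ENNReal.ofReal t)⁻¹
      ≤ ∫⁻ _ in scaleBlock d k, (2 : ℝ≥0∞) ^ (-((k : ℝ) * d)) :=
        setLIntegral_mono' (measurableSet_scaleBlock d k) fun t ht => by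
          rw [ENNReal.rpow_neg]
          exact ENNReal.inv_le_inv.2 (two_rpow_le_ofReal ht)
    _ = ENNReal.ofReal ((2 : ℝ) ^ d - 1) := by
        rw [setLIntegral_const, volume_scaleBlock, ← mul_assoc, ← two_rpow_add]
        simp

lemma le_setLIntegral_inv_scaleBlock (d : ℝ) (k : ℤ) :
    2 ^ (-d) * ENNReal.ofReal ((2 : ℝ) ^ d - 1) ≤
      ∫⁻ t in scaleBlock d k, (ENNReal.ofReal t)⁻¹ := by
  calc 2 ^ (-d) * ENNReal.ofReal ((2 : ℝ) ^ d - 1)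
      = ∫⁻ _ in scaleBlock d k, (2 : ℝ≥0∞) ^ (-(((k : ℝ) + 1) * d)) := by
        rw [setLIntegral_const, volume_scaleBlock, ← mul_assoc, ← two_rpow_add]
        ring_nf
    _ ≤ ∫⁻ t in scaleBlock d k, (ENNReal.ofReal t)⁻¹ :=
        setLIntegral_mono' (measurableSet_scaleBlock d k) fun t ht => by
          rw [ENNReal.rpow_neg]
          exact ENNReal.inv_le_inv.2 (ofReal_le_two_rpow ht)

/-- The samples `2^(-kdθ) K(2^(kd))` of `t^(-θ) K(t)`. -/
def scaleSample (K : ℝ → ℝ≥0∞) (θ d : ℝ) (k : ℤ) : ℝ≥0∞ :=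
  2 ^ (-((k : ℝ) * d * θ)) * K (2 ^ ((k : ℝ) * d))

section
variable {K : ℝ → ℝ≥0∞} {θ d : ℝ}

/-- K is evaluated at the right endpoint and t^(-θ) at the left one; this mismatch costs 2^(dθ) and
shifts the index by one. -/
lemma le_scaleSample_succ (hK : MonotoneOn K (Set.Ioi 0)) (hθ : 0 < θ) {k : ℤ} {t : ℝ}
    (ht : t ∈ scaleBlock d k) :
    ENNReal.ofReal t ^ (-θ) * K t ≤ 2 ^ (d * θ) * scaleSample K θ d (k + 1) := by
  have h1 : ENNReal.ofReal t ^ (-θ) ≤ 2 ^ (-((k : ℝ) * d * θ)) := by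
    rw [ENNReal.rpow_neg, ENNReal.rpow_neg, ENNReal.inv_le_inv, ENNReal.rpow_mul]
    gcongr
    exact two_rpow_le_ofReal ht
  have h2 : K t ≤ K (2 ^ (((k : ℝ) + 1) * d)) :=
    hK (pos_of_mem_scaleBlock ht) (Set.mem_Ioi.2 (by positivity)) ht.2.le
  rw [scaleSample, ← mul_assoc, ← two_rpow_add]
  push_cast
  refine mul_le_mul' (h1.trans (two_rpow_mono ?_)) h2
  linarith

lemma scaleSample_le (hK : MonotoneOn K (Set.Ioi 0)) (hθ : 0 < θ) {k : ℤ} {t : ℝ}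
    (ht : t ∈ scaleBlock d k) :
    scaleSample K θ d k ≤ 2 ^ (d * θ) * (ENNReal.ofReal t ^ (-θ) * K t) := by
  have h1 : (2 : ℝ≥0∞) ^ (-(((k : ℝ) + 1) * d * θ)) ≤ ENNReal.ofReal t ^ (-θ) := by
    rw [ENNReal.rpow_neg, ENNReal.rpow_neg, ENNReal.inv_le_inv, ENNReal.rpow_mul]
    gcongr
    exact ofReal_le_two_rpow ht
  have h2 : K (2 ^ ((k : ℝ) * d)) ≤ K t :=
    hK (Set.mem_Ioi.2 (by positivity)) (pos_of_mem_scaleBlock ht) ht.1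
  rw [scaleSample, ← mul_assoc]
  refine mul_le_mul' (le_trans ?_ (mul_le_mul_right h1 _)) h2
  rw [← two_rpow_add]
  refine two_rpow_mono ?_
  linarith

/-- The weighted `L^r(dt/t)` quasi-norm of `t^(-θ) K(t)`. -/
def scaleNorm (K : ℝ → ℝ≥0∞) (θ : ℝ) (r : ℝ≥0∞) : ℝ≥0∞ :=
  if r = ∞ then ⨆ (t : ℝ) (_ : 0 < t), ENNReal.ofReal t ^ (-θ) * K t
  else (∫⁻ t in Set.Ioi (0 : ℝ), (ENNReal.ofReal t ^ (-θ) * K t) ^ r.toReal / ENNReal.ofReal t)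
    ^ (1 / r.toReal)

lemma measurable_inv_ofReal : Measurable fun t : ℝ => (ENNReal.ofReal t)⁻¹ := by fun_prop

lemma lintegral_Ioi_eq_tsum_scaleBlock (hd : 0 < d) (F : ℝ → ℝ≥0∞) :
    ∫⁻ t in Set.Ioi (0 : ℝ), F t = ∑' k, ∫⁻ t in scaleBlock d k, F t := by
  rw [← iUnion_scaleBlock hd,
    lintegral_iUnion (measurableSet_scaleBlock d) (pairwise_disjoint_scaleBlock hd)]

lemma scaleNorm_le_of_pos (hθ : 0 < θ) (hd : 0 < d) {r : ℝ≥0∞} (hr : 0 < r) :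
    ∃ C : ℝ≥0∞, C ≠ ∞ ∧ ∀ K : ℝ → ℝ≥0∞, MonotoneOn K (Set.Ioi 0) →
      scaleNorm K θ r ≤ C * lrNorm r (scaleSample K θ d) := by
  rcases eq_or_ne r ∞ with rfl | h
  · refine ⟨2 ^ (d * θ), two_rpow_ne_top _, fun K hK => ?_⟩
    rw [scaleNorm, if_pos rfl, lrNorm_top]
    refine iSup₂_le fun t ht => ?_
    obtain ⟨k, hk⟩ := exists_mem_scaleBlock hd ht
    refine (le_scaleSample_succ hK hθ hk).trans ?_
    gcongr
    exact le_iSup _ (k + 1)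
  · have hp : 0 < r.toReal := ENNReal.toReal_pos hr.ne' h
    have hp' : 0 ≤ 1 / r.toReal := by positivity
    refine ⟨2 ^ (d * θ) * ENNReal.ofReal ((2 : ℝ) ^ d - 1) ^ (1 / r.toReal),
      ENNReal.mul_ne_top (two_rpow_ne_top _)
        (ENNReal.rpow_ne_top_of_nonneg hp' ENNReal.ofReal_ne_top), fun K hK => ?_⟩
    rw [scaleNorm, if_neg h, mul_assoc, mul_left_comm, ← lrNorm_const_mul hr, lrNorm_of_ne_top h,
      ← ENNReal.mul_rpow_of_nonneg _ _ hp', ← ENNReal.tsum_mul_left,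
      lintegral_Ioi_eq_tsum_scaleBlock hd]
    refine ENNReal.rpow_le_rpow ?_ hp'
    calc ∑' k, ∫⁻ t in scaleBlock d k,
          (ENNReal.ofReal t ^ (-θ) * K t) ^ r.toReal / ENNReal.ofReal t
        ≤ ∑' k, ∫⁻ t in scaleBlock d k,
          (2 ^ (d * θ) * scaleSample K θ d (k + 1)) ^ r.toReal * (ENNReal.ofReal t)⁻¹ := by
          refine ENNReal.tsum_le_tsum fun k =>
            setLIntegral_mono' (measurableSet_scaleBlock d k) fun t ht => ?_
          rw [div_eq_mul_inv]
          exact mul_le_mul_left (ENNReal.rpow_le_rpow (le_scaleSample_succ hK hθ ht) hp.le) _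
      _ ≤ ∑' k, ENNReal.ofReal ((2 : ℝ) ^ d - 1) *
            (2 ^ (d * θ) * scaleSample K θ d (k + 1)) ^ r.toReal := by
          refine ENNReal.tsum_le_tsum fun k => ?_
          rw [lintegral_const_mul _ measurable_inv_ofReal, mul_comm]
          gcongr
          exact setLIntegral_inv_scaleBlock_le d k
      -- The sum over all of ℤ absorbs the index shift.
      _ = _ := (Equiv.addRight (1 : ℤ)).tsum_eq fun k => ENNReal.ofReal ((2 : ℝ) ^ d - 1) *
            (2 ^ (d * θ) * scaleSample K θ d k) ^ r.toReal

lemma lrNorm_scaleSample_le_of_pos (hθ : 0 < θ) (hd : 0 < d) {r : ℝ≥0∞} (hr : 0 < r) :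
    ∃ C : ℝ≥0∞, C ≠ ∞ ∧ ∀ K : ℝ → ℝ≥0∞, MonotoneOn K (Set.Ioi 0) →
      lrNorm r (scaleSample K θ d) ≤ C * scaleNorm K θ r := by
  rcases eq_or_ne r ∞ with rfl | h
  · refine ⟨2 ^ (d * θ), two_rpow_ne_top _, fun K hK => ?_⟩
    rw [scaleNorm, if_pos rfl, lrNorm_top]
    refine iSup_le fun k => ?_
    have hk : (2 : ℝ) ^ ((k : ℝ) * d) ∈ scaleBlock d k :=
      ⟨le_rfl, Real.rpow_lt_rpow_of_exponent_lt (by norm_num) (by linarith)⟩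
    refine (scaleSample_le hK hθ hk).trans ?_
    gcongr
    exact le_iSup₂ (f := fun (t : ℝ) (_ : 0 < t) => ENNReal.ofReal t ^ (-θ) * K t) _
      (pos_of_mem_scaleBlock hk)
  · have hp : 0 < r.toReal := ENNReal.toReal_pos hr.ne' h
    have hp' : 0 ≤ 1 / r.toReal := by positivity
    set m : ℝ≥0∞ := 2 ^ (-d) * ENNReal.ofReal ((2 : ℝ) ^ d - 1) with hm
    have hm0 : m ≠ 0 := by
      refine mul_ne_zero ?_ ?_
      · simp [ENNReal.rpow_eq_zero_iff]
      · have := Real.one_lt_rpow (x := 2) (by norm_num) hd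
        simpa using this
    have hmt : m ≠ ∞ := ENNReal.mul_ne_top (two_rpow_ne_top _) ENNReal.ofReal_ne_top
    refine ⟨2 ^ (d * θ) * m⁻¹ ^ (1 / r.toReal),
      ENNReal.mul_ne_top (two_rpow_ne_top _)
        (ENNReal.rpow_ne_top_of_nonneg hp' (ENNReal.inv_ne_top.2 hm0)), fun K hK => ?_⟩
    have hA : (2 : ℝ≥0∞) ^ (d * θ) = ((2 : ℝ≥0∞) ^ (d * θ * r.toReal)) ^ (1 / r.toReal) := by
      rw [← ENNReal.rpow_mul]
      congr 1
      field_simp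
    rw [scaleNorm, if_neg h, lrNorm_of_ne_top h, hA, ← ENNReal.mul_rpow_of_nonneg _ _ hp',
      ← ENNReal.mul_rpow_of_nonneg _ _ hp', lintegral_Ioi_eq_tsum_scaleBlock hd]
    refine ENNReal.rpow_le_rpow ?_ hp'
    rw [mul_right_comm, ← div_eq_mul_inv, ENNReal.le_div_iff_mul_le (Or.inl hm0) (Or.inl hmt),
      ← ENNReal.tsum_mul_right, ← ENNReal.tsum_mul_left]
    refine ENNReal.tsum_le_tsum fun k => ?_
    calc scaleSample K θ d k ^ r.toReal * m
        ≤ scaleSample K θ d k ^ r.toReal * ∫⁻ t in scaleBlock d k, (ENNReal.ofReal t)⁻¹ := by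
          gcongr
          exact le_setLIntegral_inv_scaleBlock d k
      _ = ∫⁻ t in scaleBlock d k, scaleSample K θ d k ^ r.toReal * (ENNReal.ofReal t)⁻¹ :=
          (lintegral_const_mul _ measurable_inv_ofReal).symm
      _ ≤ ∫⁻ t in scaleBlock d k, 2 ^ (d * θ * r.toReal) *
            ((ENNReal.ofReal t ^ (-θ) * K t) ^ r.toReal / ENNReal.ofReal t) := by
          refine setLIntegral_mono' (measurableSet_scaleBlock d k) fun t ht => ?_
          rw [div_eq_mul_inv, ← mul_assoc, ENNReal.rpow_mul,
            ← ENNReal.mul_rpow_of_nonneg _ _ hp.le]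
          gcongr
          exact scaleSample_le hK hθ ht
      _ = _ := lintegral_const_mul' _ _ (two_rpow_ne_top _)

/-- Reflecting k ↦ -k removes the sign of d, needed because s₀ - s₁ may be negative. -/
lemma lrNorm_scaleSample_neg (r : ℝ≥0∞) (K : ℝ → ℝ≥0∞) :
    lrNorm r (scaleSample K θ (-d)) = lrNorm r (scaleSample K θ d) := by
  rw [← lrNorm_comp_equiv r (scaleSample K θ d) (Equiv.neg ℤ)]
  congr 1
  ext k
  simp [scaleSample]

lemma scaleNorm_le (hθ : 0 < θ) (hd : d ≠ 0) {r : ℝ≥0∞} (hr : 0 < r) :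
    ∃ C : ℝ≥0∞, C ≠ ∞ ∧ ∀ K : ℝ → ℝ≥0∞, MonotoneOn K (Set.Ioi 0) →
      scaleNorm K θ r ≤ C * lrNorm r (scaleSample K θ d) := by
  rcases hd.lt_or_gt with h | h
  · simpa only [lrNorm_scaleSample_neg] using scaleNorm_le_of_pos hθ (neg_pos.2 h) hr
  · exact scaleNorm_le_of_pos hθ h hr

lemma lrNorm_scaleSample_le (hθ : 0 < θ) (hd : d ≠ 0) {r : ℝ≥0∞} (hr : 0 < r) :
    ∃ C : ℝ≥0∞, C ≠ ∞ ∧ ∀ K : ℝ → ℝ≥0∞, MonotoneOn K (Set.Ioi 0) →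
      lrNorm r (scaleSample K θ d) ≤ C * scaleNorm K θ r := by
  rcases hd.lt_or_gt with h | h
  · simpa only [lrNorm_scaleSample_neg] using lrNorm_scaleSample_le_of_pos hθ (neg_pos.2 h) hr
  · exact lrNorm_scaleSample_le_of_pos hθ h hr

end

lemma realInterpNorm_eq_scaleNorm {G : Type*} [AddCommGroup G] (N₀ N₁ : G → ℝ≥0∞) (θ : ℝ)
    (r : ℝ≥0∞) (f : G) :
    realInterpNorm N₀ N₁ θ r f = scaleNorm (fun t => kFunctional N₀ N₁ t f) θ r := rfl

lemma monotone_kFunctional {G : Type*} [AddCommGroup G] (N₀ N₁ : G → ℝ≥0∞) (f : G) :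
    Monotone fun t => kFunctional N₀ N₁ t f := fun s t hst => by
  unfold kFunctional
  refine iInf₂_mono fun f₀ f₁ => iInf_mono fun _ => iInf₂_mono fun _ _ => ?_
  gcongr

lemma two_rpow_ne_zero (x : ℝ) : (2 : ℝ≥0∞) ^ x ≠ 0 := by
  simp [ENNReal.rpow_eq_zero_iff]

lemma LpAddConst_ne_zero (q : ℝ≥0∞) : ENNReal.LpAddConst q ≠ 0 := by
  unfold ENNReal.LpAddConst
  split_ifs
  · exact two_rpow_ne_zero _
  · exact one_ne_zero

/-! ### Herz quasi-norms on annuli and the K-functional. -/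

section
variable {n : ℕ} {𝕜 : Type*} [RCLike 𝕜]

/-- The `L^q` quasi-norm of `f` on the annulus `A_j`. -/
def annulusNorm (q : ℝ≥0∞) (f : MeasFun n 𝕜) (j : ℤ) : ℝ≥0∞ :=
  eLpNorm ((dyadicAnnulus n j).indicator f) q volume

lemma herzNorm_eq_lrNorm (s : ℝ) (q r : ℝ≥0∞) (f : MeasFun n 𝕜) :
    herzNorm s q r f = lrNorm r fun j => 2 ^ ((j : ℝ) * s) * annulusNorm q f j := rfl

lemma measurableSet_dyadicAnnulus (n : ℕ) (j : ℤ) : MeasurableSet (dyadicAnnulus n j) :=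
  (measurableSet_le measurable_const measurable_norm).inter
    (measurableSet_lt measurable_norm measurable_const)

lemma disjoint_dyadicAnnulus {i j : ℤ} (h : i ≠ j) :
    Disjoint (dyadicAnnulus n i) (dyadicAnnulus n j) := by
  wlog hij : i < j generalizing i j
  · exact (this h.symm (lt_of_le_of_ne (not_lt.1 hij) h.symm)).symm
  refine Set.disjoint_left.2 fun x hi hj => ?_
  have : (2 : ℝ) ^ i ≤ 2 ^ (j - 1) := zpow_le_zpow_right₀ (by norm_num) (by omega)
  exact absurd (hi.2.trans_le this) (not_lt.2 hj.1)

lemma annulusNorm_add_le (q : ℝ≥0∞) (f g : MeasFun n 𝕜) (j : ℤ) :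
    annulusNorm q (f + g) j ≤ ENNReal.LpAddConst q * (annulusNorm q f j + annulusNorm q g j) := by
  have hm := measurableSet_dyadicAnnulus n j
  have h : (dyadicAnnulus n j).indicator ⇑(f + g) =ᵐ[volume]
      (dyadicAnnulus n j).indicator ⇑f + (dyadicAnnulus n j).indicator ⇑g := by
    filter_upwards [AEEqFun.coeFn_add f g] with x hx
    by_cases hxA : x ∈ dyadicAnnulus n j <;> simp [hxA, hx]
  rw [annulusNorm, eLpNorm_congr_ae h]
  exact eLpNorm_add_le' (f.aestronglyMeasurable.indicator hm) (g.aestronglyMeasurable.indicator hm) q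

lemma annulusNorm_congr (q : ℝ≥0∞) {f g : MeasFun n 𝕜} {j : ℤ}
    (h : ∀ᵐ x, x ∈ dyadicAnnulus n j → f x = g x) : annulusNorm q f j = annulusNorm q g j := by
  refine eLpNorm_congr_ae ?_
  filter_upwards [h] with x hx
  by_cases hxA : x ∈ dyadicAnnulus n j <;> simp [hxA, hx]

lemma annulusNorm_zero (q : ℝ≥0∞) (j : ℤ) : annulusNorm q (0 : MeasFun n 𝕜) j = 0 := by
  have h : (dyadicAnnulus n j).indicator ⇑(0 : MeasFun n 𝕜) =ᵐ[volume] 0 := by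
    filter_upwards [AEEqFun.coeFn_zero (α := EuclideanSpace ℝ (Fin n)) (β := 𝕜) (μ := volume)]
      with x hx
    by_cases hxA : x ∈ dyadicAnnulus n j <;> simp [hxA, hx]
  rw [annulusNorm, eLpNorm_congr_ae h, eLpNorm_zero]

/-- Splitting `f` along a family of annuli. -/
lemma exists_annulus_splitting (f : MeasFun n 𝕜) (J : Set ℤ) :
    ∃ g h : MeasFun n 𝕜, f = g + h ∧
      (∀ q, ∀ j ∈ J, annulusNorm q g j = annulusNorm q f j ∧ annulusNorm q h j = 0) ∧
      ∀ q, ∀ j ∉ J, annulusNorm q g j = 0 ∧ annulusNorm q h j = annulusNorm q f j := by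
  set E : Set (EuclideanSpace ℝ (Fin n)) := ⋃ j ∈ J, dyadicAnnulus n j with hE
  have hEm : MeasurableSet E := MeasurableSet.biUnion J.to_countable fun j _ =>
    measurableSet_dyadicAnnulus n j
  set g : MeasFun n 𝕜 := AEEqFun.mk (E.indicator f) (f.aestronglyMeasurable.indicator hEm)
  set h : MeasFun n 𝕜 := AEEqFun.mk (Eᶜ.indicator f) (f.aestronglyMeasurable.indicator hEm.compl)
  have hg : g =ᵐ[volume] E.indicator f := AEEqFun.coeFn_mk _ _
  have hh : h =ᵐ[volume] Eᶜ.indicator f := AEEqFun.coeFn_mk _ _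
  have h0 : (0 : MeasFun n 𝕜) =ᵐ[volume] 0 := AEEqFun.coeFn_zero
  refine ⟨g, h, ?_, fun q j hj => ?_, fun q j hj => ?_⟩
  · refine AEEqFun.ext ?_
    filter_upwards [hg, hh, AEEqFun.coeFn_add g h] with x hxg hxh hx
    rw [hx, Pi.add_apply, hxg, hxh, Set.indicator_self_add_compl_apply]
  · have hin : ∀ x ∈ dyadicAnnulus n j, x ∈ E := fun x hx => Set.mem_biUnion hj hx
    constructor
    · refine annulusNorm_congr q ?_
      filter_upwards [hg] with x hxg hx
      rw [hxg, Set.indicator_of_mem (hin x hx)]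
    · rw [← annulusNorm_zero (n := n) (𝕜 := 𝕜) q j]
      refine annulusNorm_congr q ?_
      filter_upwards [hh, h0] with x hxh hx0 hx
      rw [hxh, hx0, Set.indicator_of_notMem (Set.notMem_compl_iff.2 (hin x hx)), Pi.zero_apply]
  · have hout : ∀ x ∈ dyadicAnnulus n j, x ∉ E := fun x hx hxE => by
      obtain ⟨i, hi, hxi⟩ := Set.mem_iUnion₂.1 hxE
      have hij : i ≠ j := fun h => hj (h ▸ hi)
      exact Set.disjoint_left.1 (disjoint_dyadicAnnulus hij) hxi hx
    constructor
    · rw [← annulusNorm_zero (n := n) (𝕜 := 𝕜) q j]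
      refine annulusNorm_congr q ?_
      filter_upwards [hg, h0] with x hxg hx0 hx
      rw [hxg, hx0, Set.indicator_of_notMem (hout x hx), Pi.zero_apply]
    · refine annulusNorm_congr q ?_
      filter_upwards [hh] with x hxh hx
      rw [hxh, Set.indicator_of_mem (Set.mem_compl (hout x hx))]

variable {θ s s₀ s₁ : ℝ} {q r₀ r₁ : ℝ≥0∞}

/-- The sampling points are chosen so that 2^(ks) equals both 2^(-kdθ) 2^(ks₀) and 2^(-kdθ) 2^(kd)
2^(ks₁), with d = s₀ - s₁. -/
lemma annulusNorm_le_scaleSample (hr₀ : 0 < r₀) (hr₁ : 0 < r₁)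
    (hs : s = (1 - θ) * s₀ + θ * s₁) (f : MeasFun n 𝕜) (k : ℤ) :
    2 ^ ((k : ℝ) * s) * annulusNorm q f k ≤ ENNReal.LpAddConst q *
      scaleSample (fun t => kFunctional (herzNorm s₀ q r₀) (herzNorm s₁ q r₁) t f)
        θ (s₀ - s₁) k := by
  simp only [scaleSample, kFunctional, ENNReal.mul_iInf_of_ne (two_rpow_ne_zero _)
    (two_rpow_ne_top _), ENNReal.mul_iInf_of_ne (LpAddConst_ne_zero q) (ENNReal.LpAddConst_lt_top q).ne]
  refine le_iInf fun f₀ => le_iInf fun f₁ => le_iInf fun hf => le_iInf fun _ => le_iInf fun _ => ?_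
  have h₀ := le_lrNorm hr₀ (fun j => 2 ^ ((j : ℝ) * s₀) * annulusNorm q f₀ j) k
  have h₁ := le_lrNorm hr₁ (fun j => 2 ^ ((j : ℝ) * s₁) * annulusNorm q f₁ j) k
  rw [← herzNorm_eq_lrNorm] at h₀ h₁
  calc 2 ^ ((k : ℝ) * s) * annulusNorm q f k
      ≤ 2 ^ ((k : ℝ) * s) * (ENNReal.LpAddConst q * (annulusNorm q f₀ k + annulusNorm q f₁ k)) := by
        rw [hf]
        gcongr
        exact annulusNorm_add_le q f₀ f₁ k
    _ = ENNReal.LpAddConst q * (2 ^ (-((k : ℝ) * (s₀ - s₁) * θ)) *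
          (2 ^ ((k : ℝ) * s₀) * annulusNorm q f₀ k +
            2 ^ ((k : ℝ) * (s₀ - s₁)) * (2 ^ ((k : ℝ) * s₁) * annulusNorm q f₁ k))) := by
        rw [mul_left_comm]
        congr 1
        rw [mul_add, mul_add]
        simp only [← mul_assoc, ← two_rpow_add]
        rw [hs]
        ring_nf
    _ ≤ _ := by
        rw [ofReal_two_rpow]
        gcongr

/-- On the X₀ side the weights decay at rate θ|s₀ - s₁| away from k, on the X₁ side at rate (1 -
θ)|s₀ - s₁|. The number ε is half the smaller rate. -/
lemma exists_scaleSample_le_iSup (hr₀ : 0 < r₀) (hr₁ : 0 < r₁) (hθ₀ : 0 < θ) (hθ₁ : θ < 1)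
    (hne : s₀ ≠ s₁) (hs : s = (1 - θ) * s₀ + θ * s₁) :
    ∃ ε : ℝ, 0 < ε ∧ ∃ C : ℝ≥0∞, C ≠ ∞ ∧ ∀ (f : MeasFun n 𝕜) (k : ℤ),
      scaleSample (fun t => kFunctional (herzNorm s₀ q r₀) (herzNorm s₁ q r₁) t f)
        θ (s₀ - s₁) k ≤
        C * ⨆ j : ℤ, expWeight ε (k - j) * (2 ^ ((j : ℝ) * s) * annulusNorm q f j) := by
  have hd : 0 < |s₀ - s₁| := abs_pos.2 (sub_ne_zero.2 hne)
  have hmin : 0 < min θ (1 - θ) := lt_min hθ₀ (by linarith)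
  obtain ⟨ε, hε⟩ : ∃ ε, ε = min θ (1 - θ) * |s₀ - s₁| / 2 := ⟨_, rfl⟩
  have hε0 : 0 < ε := by rw [hε]; positivity
  have hεθ : ε + ε ≤ θ * |s₀ - s₁| := by
    rw [hε, add_halves]
    gcongr
    exact min_le_left _ _
  have hεθ' : ε + ε ≤ (1 - θ) * |s₀ - s₁| := by
    rw [hε, add_halves]
    gcongr
    exact min_le_right _ _
  have hL₀ := lrNorm_expWeight_ne_top hε0 hr₀
  have hL₁ := lrNorm_expWeight_ne_top hε0 hr₁
  set L₀ := lrNorm r₀ (expWeight ε)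
  set L₁ := lrNorm r₁ (expWeight ε)
  -- The extra 1 makes the constant visibly nonzero, so that its product with S = ∞ is ∞.
  refine ⟨ε, hε0, L₀ + L₁ + 1, by simp [hL₀, hL₁], fun f k => ?_⟩
  set b : ℤ → ℝ≥0∞ := fun j => 2 ^ ((j : ℝ) * s) * annulusNorm q f j with hb
  change _ ≤ _ * ⨆ j, expWeight ε (k - j) * b j
  set S := ⨆ j, expWeight ε (k - j) * b j with hS
  -- Finiteness of S is what makes the two pieces admissible in the infimum.
  rcases eq_or_ne S ∞ with hS' | hS'
  · rw [hS', ENNReal.mul_top (by simp)]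
    exact le_top
  obtain ⟨g, h, hf, hJ, hJ'⟩ := exists_annulus_splitting f
    {j : ℤ | (j : ℝ) * (s₀ - s₁) ≤ k * (s₀ - s₁)}
  have hg : herzNorm s₀ q r₀ g ≤ 2 ^ ((k : ℝ) * (s₀ - s₁) * θ) * (L₀ * S) := by
    refine le_trans ?_ (mul_le_mul_right (lrNorm_expWeight_mul_le hr₀ ε b k) _)
    rw [← lrNorm_const_mul hr₀, herzNorm_eq_lrNorm]
    refine lrNorm_mono _ fun j => ?_
    by_cases hj : (j : ℝ) * (s₀ - s₁) ≤ k * (s₀ - s₁)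
    · rw [(hJ q j hj).1, hb, expWeight]
      simp only [← mul_assoc, ← two_rpow_add]
      refine mul_le_mul_left (two_rpow_mono ?_) _
      -- The cut fixes the sign of (k - j)(s₀ - s₁), turning the exponent into decay in |k - j|.
      have h1 : |s₀ - s₁| * |((k - j : ℤ) : ℝ)| = (k - j) * (s₀ - s₁) := by
        rw [← abs_mul, abs_of_nonneg] <;> push_cast <;> linarith
      have h2 := mul_le_mul_of_nonneg_right hεθ (abs_nonneg ((k - j : ℤ) : ℝ))
      rw [mul_assoc, h1] at h2
      rw [hs]
      linarith
    · rw [(hJ' q j hj).1, mul_zero]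
      exact zero_le
  have hh : herzNorm s₁ q r₁ h ≤ 2 ^ (-((k : ℝ) * (s₀ - s₁) * (1 - θ))) * (L₁ * S) := by
    refine le_trans ?_ (mul_le_mul_right (lrNorm_expWeight_mul_le hr₁ ε b k) _)
    rw [← lrNorm_const_mul hr₁, herzNorm_eq_lrNorm]
    refine lrNorm_mono _ fun j => ?_
    by_cases hj : (j : ℝ) * (s₀ - s₁) ≤ k * (s₀ - s₁)
    · rw [(hJ q j hj).2, mul_zero]
      exact zero_le
    · rw [(hJ' q j hj).2, hb, expWeight]
      simp only [← mul_assoc, ← two_rpow_add]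
      refine mul_le_mul_left (two_rpow_mono ?_) _
      have h1 : |s₀ - s₁| * |((k - j : ℤ) : ℝ)| = -((k - j) * (s₀ - s₁)) := by
        rw [← abs_mul, abs_of_nonpos] <;> push_cast <;> linarith
      have h2 := mul_le_mul_of_nonneg_right hεθ' (abs_nonneg ((k - j : ℤ) : ℝ))
      rw [mul_assoc, h1] at h2
      rw [hs]
      linarith
  have hg' : herzNorm s₀ q r₀ g < ∞ := hg.trans_lt
    (ENNReal.mul_lt_top (two_rpow_ne_top _).lt_top (ENNReal.mul_lt_top hL₀.lt_top hS'.lt_top))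
  have hh' : herzNorm s₁ q r₁ h < ∞ := hh.trans_lt
    (ENNReal.mul_lt_top (two_rpow_ne_top _).lt_top (ENNReal.mul_lt_top hL₁.lt_top hS'.lt_top))
  calc scaleSample (fun t => kFunctional (herzNorm s₀ q r₀) (herzNorm s₁ q r₁) t f)
        θ (s₀ - s₁) k
      ≤ 2 ^ (-((k : ℝ) * (s₀ - s₁) * θ)) *
          (herzNorm s₀ q r₀ g + 2 ^ ((k : ℝ) * (s₀ - s₁)) * herzNorm s₁ q r₁ h) := by
        rw [← ofReal_two_rpow ((k : ℝ) * (s₀ - s₁))]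
        refine mul_le_mul_right ?_ _
        exact iInf_le_of_le g (iInf_le_of_le h (iInf_le_of_le hf (iInf_le_of_le hg'
          (iInf_le_of_le hh' le_rfl))))
    _ ≤ 2 ^ (-((k : ℝ) * (s₀ - s₁) * θ)) * (2 ^ ((k : ℝ) * (s₀ - s₁) * θ) * (L₀ * S) +
          2 ^ ((k : ℝ) * (s₀ - s₁)) * (2 ^ (-((k : ℝ) * (s₀ - s₁) * (1 - θ))) * (L₁ * S))) := by
        gcongr
    _ = (L₀ + L₁) * S := by
        rw [mul_add]
        simp only [← mul_assoc, ← two_rpow_add]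
        have e1 : -((k : ℝ) * (s₀ - s₁) * θ) + (k : ℝ) * (s₀ - s₁) * θ = 0 := by ring
        have e2 : -((k : ℝ) * (s₀ - s₁) * θ) + ((k : ℝ) * (s₀ - s₁) +
          -((k : ℝ) * (s₀ - s₁) * (1 - θ))) = 0 := by ring
        rw [e1, e2]
        simp [add_mul]
    _ ≤ (L₀ + L₁ + 1) * S := mul_le_mul_left le_self_add _

end

/-! ### The two norm estimates and the conclusion. -/

lemma exists_realInterpNorm_herzNorm_le {𝕜 : Type*} [RCLike 𝕜] (n : ℕ) {θ s s₀ s₁ : ℝ}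
    (hθ₀ : 0 < θ) (hθ₁ : θ < 1) {r r₀ r₁ : ℝ≥0∞} (q : ℝ≥0∞) (hr : 0 < r) (hr₀ : 0 < r₀)
    (hr₁ : 0 < r₁) (hne : s₀ ≠ s₁) (hs : s = (1 - θ) * s₀ + θ * s₁) :
    ∃ C : ℝ≥0∞, C ≠ ∞ ∧ ∀ f : MeasFun n 𝕜,
      realInterpNorm (herzNorm s₀ q r₀) (herzNorm s₁ q r₁) θ r f ≤ C * herzNorm s q r f := by
  obtain ⟨ε, hε, C, hC, h⟩ :=
    exists_scaleSample_le_iSup (n := n) (𝕜 := 𝕜) (q := q) hr₀ hr₁ hθ₀ hθ₁ hne hs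
  obtain ⟨D, hD, h'⟩ := scaleNorm_le hθ₀ (sub_ne_zero.2 hne) hr
  refine ⟨D * (C * lrNorm r (expWeight ε)),
    ENNReal.mul_ne_top hD (ENNReal.mul_ne_top hC (lrNorm_expWeight_ne_top hε hr)), fun f => ?_⟩
  rw [realInterpNorm_eq_scaleNorm, mul_assoc, mul_assoc, herzNorm_eq_lrNorm]
  refine (h' _ ((monotone_kFunctional _ _ f).monotoneOn _)).trans (mul_le_mul_right ?_ _)
  refine (lrNorm_mono r (h f)).trans ?_
  rw [lrNorm_const_mul hr]
  exact mul_le_mul_right (lrNorm_iSup_expWeight_mul_le hr ε _) _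

lemma exists_herzNorm_le_realInterpNorm {𝕜 : Type*} [RCLike 𝕜] (n : ℕ) {θ s s₀ s₁ : ℝ}
    (hθ₀ : 0 < θ) {r r₀ r₁ : ℝ≥0∞} (q : ℝ≥0∞) (hr : 0 < r) (hr₀ : 0 < r₀)
    (hr₁ : 0 < r₁) (hne : s₀ ≠ s₁) (hs : s = (1 - θ) * s₀ + θ * s₁) :
    ∃ C : ℝ≥0∞, C ≠ ∞ ∧ ∀ f : MeasFun n 𝕜,
      herzNorm s q r f ≤ C * realInterpNorm (herzNorm s₀ q r₀) (herzNorm s₁ q r₁) θ r f := by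
  obtain ⟨D, hD, h'⟩ := lrNorm_scaleSample_le hθ₀ (sub_ne_zero.2 hne) hr
  refine ⟨ENNReal.LpAddConst q * D, ENNReal.mul_ne_top (ENNReal.LpAddConst_lt_top q).ne hD, fun f => ?_⟩
  rw [realInterpNorm_eq_scaleNorm, mul_assoc, herzNorm_eq_lrNorm]
  refine (lrNorm_mono r (annulusNorm_le_scaleSample hr₀ hr₁ hs f)).trans ?_
  rw [lrNorm_const_mul hr]
  exact mul_le_mul_right (h' _ ((monotone_kFunctional _ _ f).monotoneOn _)) _

end

theorem theorem2p7 {𝕜 : Type*} [RCLike 𝕜] (n : ℕ) (hn : 1 ≤ n)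
    (θ s s₀ s₁ : ℝ) (hθ₀ : 0 < θ) (hθ₁ : θ < 1)
    (q r r₀ r₁ : ℝ≥0∞) (hq : 0 < q) (hr : 0 < r) (hr₀ : 0 < r₀) (hr₁ : 0 < r₁)
    (hne : s₀ ≠ s₁) (hs : s = (1 - θ) * s₀ + θ * s₁) :
    realInterpSpace (herzNorm (n := n) (𝕜 := 𝕜) s₀ q r₀) (herzNorm s₁ q r₁) θ r
        = herzSpace n 𝕜 s q r ∧
      ∃ c C : ℝ≥0, 0 < c ∧ 0 < C ∧ ∀ f : MeasFun n 𝕜,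
        (c : ℝ≥0∞) * herzNorm s q r f
            ≤ realInterpNorm (herzNorm s₀ q r₀) (herzNorm s₁ q r₁) θ r f ∧
          realInterpNorm (herzNorm s₀ q r₀) (herzNorm s₁ q r₁) θ r f
            ≤ (C : ℝ≥0∞) * herzNorm s q r f := by
  obtain ⟨C, hC, hup⟩ := exists_realInterpNorm_herzNorm_le (𝕜 := 𝕜) n hθ₀ hθ₁ q hr hr₀ hr₁ hne hs
  obtain ⟨D, hD, hlow⟩ := exists_herzNorm_le_realInterpNorm (𝕜 := 𝕜) n hθ₀ q hr hr₀ hr₁ hne hs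
  lift C to ℝ≥0 using hC
  lift D to ℝ≥0 using hD
  -- Adding 1 ensures positive constants, since C and D are only known to be finite.
  refine ⟨?_, (D + 1)⁻¹, C + 1, by positivity, by positivity, fun f => ⟨?_, ?_⟩⟩
  · ext f
    exact ⟨fun hf => (hlow f).trans_lt (ENNReal.mul_lt_top ENNReal.coe_lt_top hf),
      fun hf => (hup f).trans_lt (ENNReal.mul_lt_top ENNReal.coe_lt_top hf)⟩
  · rw [ENNReal.coe_inv (by positivity), mul_comm, ← div_eq_mul_inv]
    refine ENNReal.div_le_of_le_mul' ((hlow f).trans ?_)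
    gcongr
    exact le_self_add
  · refine (hup f).trans ?_
    gcongr
    exact le_self_add
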